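/- Let $f\in W^{1,2}(\mathbb{R}^2)$, that is, $f\in L^2(\mathbb{R}^2)$ is real-valued and has a weak gradient in $L^2(\mathbb{R}^2;\mathbb{R}^2)$. Take $f$ to be its precise representative: for every $x\in\mathbb{R}^2$, $$f(x)=\lim_{r\searrow 0}\frac{1}{\mathcal{L}^2(B(x,r))}\int_{B(x,r)} f(y)\,dy$$ if this limit exists and is finite, and $f(x)=0$ otherwise, where $B(x,r)$ is the open ball of radius $r$ centred at $x$ and $\mathcal{L}^2$ is Lebesgue measure. Let $E^*\subset\mathbb{R}^2$ be the union of all sets $C$ such that $C$ is a connected component of a level set $\{x\in\mathbb{R}^2 : f(x)=t\}$ for some $t\in\mathbb{R}$ and $\mathcal{H}^1(C)>0$, where $\mathcal{H}^1$ is one-dimensional Hausdorff measure. Then $E^*$ is a Borel set. -/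

import Mathlib

open MeasureTheory Filter Topology Set
open scoped ContDiff

/-- `G` is the weak (distributional) gradient of `f` on `ℝ²`, tested against `C_c^∞(ℝ²)`. -/
def HasWeakGradient (f : EuclideanSpace ℝ (Fin 2) → ℝ)
    (G : EuclideanSpace ℝ (Fin 2) → EuclideanSpace ℝ (Fin 2)) : Prop :=
  LocallyIntegrable f volume ∧ LocallyIntegrable G volume ∧
    ∀ φ : EuclideanSpace ℝ (Fin 2) → ℝ, ContDiff ℝ ∞ φ → HasCompactSupport φ → ∀ i : Fin 2,
      ∫ x, f x * fderiv ℝ φ x (EuclideanSpace.single i 1) = -∫ x, G x i * φ x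

/-- The Sobolev space `W^{1,2}(ℝ²)`: `f ∈ L²` with a weak gradient in `L²`. -/
def MemW12 (f : EuclideanSpace ℝ (Fin 2) → ℝ) : Prop :=
  MemLp f 2 volume ∧
    ∃ G : EuclideanSpace ℝ (Fin 2) → EuclideanSpace ℝ (Fin 2),
      MemLp G 2 volume ∧ HasWeakGradient f G

open Classical in
/-- The precise representative of `f`: the limit of the means of `f` over the open balls
`B(x, r)` as `r ↘ 0` if this limit exists and is finite, and `0` otherwise. -/
noncomputable def preciseRep (f : EuclideanSpace ℝ (Fin 2) → ℝ)
    (x : EuclideanSpace ℝ (Fin 2)) : ℝ :=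
  if h : ∃ c : ℝ, Tendsto (fun r : ℝ => ⨍ y in Metric.ball x r, f y) (𝓝[>] 0) (𝓝 c)
  then h.choose else 0

/-- `C` is a connected component of some level set `{g = t}`. -/
def IsLevelSetComponent (g : EuclideanSpace ℝ (Fin 2) → ℝ)
    (C : Set (EuclideanSpace ℝ (Fin 2))) : Prop :=
  ∃ t : ℝ, ∃ x ∈ {z | g z = t}, C = connectedComponentIn {z | g z = t} x

/-- The union of all connected components of level sets of `g` that have positive
one-dimensional Hausdorff measure. -/
def EStar (g : EuclideanSpace ℝ (Fin 2) → ℝ) : Set (EuclideanSpace ℝ (Fin 2)) :=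
  ⋃₀ {C | IsLevelSetComponent g C ∧ 0 < Measure.hausdorffMeasure 1 C}

/-! A connected component has positive `H¹` measure iff it has two points, since the distance to a
point is 1-Lipschitz and maps a connected set onto an interval. So `EStar` is the countable union of
the sets `levelReach g (1 / (n + 1))`, and it is enough that each of these is closed when `g` is the
precise representative (`isClosed_levelReach_preciseRep`).

Let `x k → a`, with connected sets `C k ∋ x k` reaching distance `R` inside level sets of values `t
k`. An ultralimit of fine chains in the `C k` is a connected set `K ∋ a` reaching distance `R`
(`exists_isPreconnected_ultralimit`). For `z ∈ K` and small `r`, many `C k` cross the annulus of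
radii `r / 2` and `r` about `z`. A one-dimensional maximal estimate for the radial projection of
`‖G‖² dx` gives a radius whose whole circle consists of points where energy on smaller balls decays
linearly. `C k` meets that circle, and a telescoping Poincaré estimate at the meeting point shows
that `t k` is close to the mean of `f` over `B(z, r)`, with an error that vanishes with the energy
near `z`. Hence the means at every `z ∈ K` converge to the single number `lim t k`, and `preciseRep
f` is constant on `K`. -/

open Metric ContinuousLinearMap Convolution

/-! ### Ball integrals under mollification. -/

section Mollification

variable {E : Type*} [NormedAddCommGroup E] [InnerProductSpace ℝ E] [FiniteDimensional ℝ E]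
  [MeasurableSpace E] [BorelSpace E]

theorem indicator_ball_convolution (ρ : ℝ) (g : E → ℝ) (z : E) :
    ((ball (0 : E) ρ).indicator (fun _ => (1 : ℝ)) ⋆[lsmul ℝ ℝ, volume] g) z
      = ∫ x in ball z ρ, g x := by
  rw [convolution_eq_swap, ← integral_indicator measurableSet_ball]
  refine integral_congr_ae (Eventually.of_forall fun t => ?_)
  by_cases h : t ∈ ball z ρ
  · have : z - t ∈ ball (0 : E) ρ := by
      simpa [dist_eq_norm, norm_sub_rev] using h
    simp [h, this]
  · have : z - t ∉ ball (0 : E) ρ := by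
      simpa [dist_eq_norm, norm_sub_rev] using h
    simp [h, this]

theorem continuous_setIntegral_ball [Nontrivial E] {g : E → ℝ}
    (hg : LocallyIntegrable g volume) (ρ : ℝ) :
    Continuous fun z => ∫ x in ball z ρ, g x := by
  simp_rw [← integral_indicator measurableSet_ball]
  refine continuous_iff_continuousAt.2 fun z => ?_
  refine continuousAt_of_dominated
    (bound := (closedBall z (ρ + 1)).indicator fun x => ‖g x‖) ?_ ?_ ?_ ?_
  · exact Eventually.of_forall fun y =>
      hg.aestronglyMeasurable.indicator measurableSet_ball
  · filter_upwards [ball_mem_nhds z one_pos] with y hy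
    refine Eventually.of_forall fun x => ?_
    rw [norm_indicator_eq_indicator_norm]
    refine indicator_le_indicator_of_subset ?_ (fun _ => norm_nonneg _) x
    intro w hw
    simp only [mem_ball, mem_closedBall] at *
    linarith [dist_triangle w y z]
  · rw [integrable_indicator_iff measurableSet_closedBall]
    exact (hg.integrableOn_isCompact (isCompact_closedBall _ _)).norm
  · have h0 : ∀ᵐ x : E, x ∉ sphere z ρ := by
      exact measure_eq_zero_iff_ae_notMem.1 (Measure.addHaar_sphere volume z ρ)
    filter_upwards [h0] with x hx
    rcases lt_or_gt_of_ne (show dist x z ≠ ρ from hx) with h | h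
    · have : ∀ᶠ y in 𝓝 z, dist x y < ρ :=
        (continuous_const.dist continuous_id).continuousAt.eventually_lt
          (continuousAt_const) h
      refine ContinuousAt.congr (f := fun _ => g x) continuousAt_const ?_
      filter_upwards [this] with y hy
      rw [indicator_of_mem (show x ∈ ball y ρ from hy)]
    · have : ∀ᶠ y in 𝓝 z, ρ < dist x y :=
        continuousAt_const.eventually_lt
          (continuous_const.dist continuous_id).continuousAt h
      refine ContinuousAt.congr (f := fun _ => 0) continuousAt_const ?_
      filter_upwards [this] with y hy
      rw [indicator_of_notMem (by simpa using hy.le)]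

/-- Integration over balls of radius `ρ` is convolution with an indicator, so it commutes with
mollification. -/
theorem setIntegral_ball_mollify [Nontrivial E] (φ : ContDiffBump (0 : E)) {g : E → ℝ}
    (hg : LocallyIntegrable g volume) (ρ : ℝ) (z : E) :
    ∫ x in ball z ρ, (φ.normed volume ⋆[lsmul ℝ ℝ, volume] g) x
      = (φ.normed volume ⋆[lsmul ℝ ℝ, volume] fun y => ∫ x in ball y ρ, g x) z := by
  set χ : E → ℝ := (ball (0 : E) ρ).indicator fun _ => (1 : ℝ) with hχ
  set η : E → ℝ := φ.normed volume
  have hηc : Continuous η := φ.continuous_normed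
  have hηs : HasCompactSupport η := φ.hasCompactSupport_normed
  have hχi : Integrable χ := by
    rw [hχ, integrable_indicator_iff measurableSet_ball]
    exact integrableOn_const (by exact measure_ball_lt_top.ne)
  have hgn : LocallyIntegrable (fun x => ‖g x‖) volume := fun x => (hg x).norm
  have hχn : (fun x => ‖χ x‖) = χ := by
    funext x; by_cases h : x ∈ ball (0 : E) ρ <;> simp [hχ, h]
  have hηn : (fun x => ‖η x‖) = η := by
    funext x; exact Real.norm_of_nonneg (φ.nonneg_normed x)
  have hchi : ∀ h : E → ℝ, LocallyIntegrable h volume → ConvolutionExists χ h (lsmul ℝ ℝ) volume := by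
    intro h hh x
    rw [convolutionExistsAt_iff_integrable_swap]
    have : (fun t => lsmul ℝ ℝ (χ (x - t)) (h t)) = (ball x ρ).indicator h := by
      funext t
      by_cases ht : t ∈ ball x ρ
      · have : x - t ∈ ball (0 : E) ρ := by simpa [dist_eq_norm, norm_sub_rev] using ht
        simp [hχ, ht, this]
      · have : x - t ∉ ball (0 : E) ρ := by simpa [dist_eq_norm, norm_sub_rev] using ht
        simp [hχ, ht, this]
    rw [this, integrable_indicator_iff measurableSet_ball]
    exact (hh.integrableOn_isCompact (isCompact_closedBall x ρ)).mono_set ball_subset_closedBall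
  have e1 : ((χ ⋆[lsmul ℝ ℝ, volume] η) ⋆[lsmul ℝ ℝ, volume] g) z
      = (χ ⋆[lsmul ℝ ℝ, volume] (η ⋆[lsmul ℝ ℝ, volume] g)) z := by
    refine convolution_assoc _ _ _ _ (fun x y z => ?_) hχi.aestronglyMeasurable
      hηc.aestronglyMeasurable hg.aestronglyMeasurable ?_ ?_ ?_
    · simp [mul_assoc]
    · exact Eventually.of_forall (hηs.convolutionExists_right _ hχi.locallyIntegrable hηc)
    · rw [hηn]
      exact Eventually.of_forall (hηs.convolutionExists_left _ hηc hgn)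
    · rw [hηn, hχn]
      exact hchi _ (hηs.continuous_convolution_left _ hηc hgn).locallyIntegrable z
  have e2 : ((η ⋆[lsmul ℝ ℝ, volume] χ) ⋆[lsmul ℝ ℝ, volume] g) z
      = (η ⋆[lsmul ℝ ℝ, volume] (χ ⋆[lsmul ℝ ℝ, volume] g)) z := by
    refine convolution_assoc _ _ _ _ (fun x y z => ?_)
      hηc.aestronglyMeasurable hχi.aestronglyMeasurable hg.aestronglyMeasurable ?_ ?_ ?_
    · simp [mul_assoc]
    · exact Eventually.of_forall (hηs.convolutionExists_left _ hηc hχi.locallyIntegrable)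
    · rw [hχn]
      exact Eventually.of_forall (hchi _ hgn)
    · rw [hηn, hχn]
      refine hηs.convolutionExists_left _ hηc (Continuous.locallyIntegrable ?_) z
      refine (continuous_setIntegral_ball hgn ρ).congr fun y => ?_
      rw [← indicator_ball_convolution]; rfl
  have e3 : χ ⋆[lsmul ℝ ℝ, volume] η = η ⋆[lsmul ℝ ℝ, volume] χ := by
    rw [← convolution_flip]
    congr 1
    ext; simp 
  rw [← indicator_ball_convolution, ← e1, e3, e2]
  congr 1
  funext y
  exact indicator_ball_convolution ρ g y

theorem tendsto_setIntegral_ball_mollify [Nontrivial E] {ι : Type*} {l : Filter ι}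
    {φ : ι → ContDiffBump (0 : E)} (hφ : Tendsto (fun i => (φ i).rOut) l (𝓝 0)) {g : E → ℝ}
    (hg : LocallyIntegrable g volume) (ρ : ℝ) (z : E) :
    Tendsto (fun i => ∫ x in ball z ρ, ((φ i).normed volume ⋆[lsmul ℝ ℝ, volume] g) x) l
      (𝓝 (∫ x in ball z ρ, g x)) := by
  simp_rw [setIntegral_ball_mollify _ hg]
  exact ContDiffBump.convolution_tendsto_right_of_continuous hφ
    (continuous_setIntegral_ball hg ρ) z

end Mollification

/-! ### Poincaré-type comparison of means over two balls. -/

section Poincare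

local notation "ℝ²" => EuclideanSpace ℝ (Fin 2)

theorem setIntegral_ball_rescale (h : ℝ² → ℝ) (c : ℝ²) {ρ : ℝ} (hρ : 0 < ρ) :
    ∫ u in ball (0 : ℝ²) 1, h (c + ρ • u) = (ρ ^ 2)⁻¹ * ∫ x in ball c ρ, h x := by
  have h1 := Measure.setIntegral_comp_smul_of_pos (volume : Measure ℝ²) (fun x => h (c + x))
    (ball (0 : ℝ²) 1) hρ
  rw [h1, smul_unitBall_of_pos hρ, finrank_euclideanSpace_fin, smul_eq_mul]
  congr 1
  rw [← integral_indicator measurableSet_ball, ← integral_indicator measurableSet_ball,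
    ← integral_add_left_eq_self ((ball c ρ).indicator h) c]
  refine integral_congr_ae (Eventually.of_forall fun x => ?_)
  by_cases hx : ‖x‖ < ρ <;> simp [indicator, hx]

theorem setAverage_ball_eq (h : ℝ² → ℝ) (c : ℝ²) {ρ : ℝ} (hρ : 0 < ρ) :
    ⨍ x in ball c ρ, h x = Real.pi⁻¹ * ((ρ ^ 2)⁻¹ * ∫ x in ball c ρ, h x) := by
  rw [setAverage_eq, measureReal_def, EuclideanSpace.volume_ball_fin_two]
  rw [smul_eq_mul, ENNReal.toReal_mul, ENNReal.toReal_pow, ENNReal.toReal_ofReal hρ.le]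
  have : (ENNReal.ofReal Real.pi).toReal = Real.pi := ENNReal.toReal_ofReal Real.pi_pos.le
  rw [this]
  rw [mul_inv]; ring

/-- Centre and radius are moved linearly from one ball to the other; after rescaling to the unit
ball, the mean is differentiated under the integral sign. All intermediate balls have radius at
least `m` and stay in `B(w, R)`. A majorant `H` replaces the gradient norm so that mollified `‖G‖`
can be used. -/
theorem abs_setAverage_ball_sub_le_of_hasFDerivAt {h H : ℝ² → ℝ} {h' : ℝ² → ℝ² →L[ℝ] ℝ}
    (hh : ∀ x, HasFDerivAt h (h' x) x) (hH : Continuous H) (hH0 : ∀ x, 0 ≤ H x)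
    (hbd : ∀ x v, |h' x v| ≤ ‖v‖ * H x) {z y w : ℝ²} {ρ ρ' m R : ℝ} (hm : 0 < m)
    (hmρ : m ≤ ρ) (hmρ' : m ≤ ρ') (hz : dist z w + ρ ≤ R) (hy : dist y w + ρ' ≤ R) :
    |(⨍ x in ball z ρ, h x) - ⨍ x in ball y ρ', h x|
      ≤ (dist z y + |ρ - ρ'|) * (Real.pi⁻¹ * ((m ^ 2)⁻¹ * ∫ x in ball w R, H x)) := by
  have hcont : Continuous h := continuous_iff_continuousAt.2 fun x => (hh x).continuousAt
  have hH'm : ∀ (L : ℝ² → ℝ²) (L' : ℝ² → ℝ²), Continuous L → Continuous L' →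
      Measurable fun u => h' (L u) (L' u) := by
    intro L L' hL hL'
    have e : h' = fderiv ℝ h := funext fun x => (hh x).fderiv.symm
    rw [e]
    have m1 : Measurable fun u => fderiv ℝ h (L u) := (measurable_fderiv ℝ h).comp hL.measurable
    exact (isBoundedBilinearMap_apply.continuous.measurable).comp
      (m1.prodMk hL'.measurable)
  set c : ℝ → ℝ² := fun s => z + s • (y - z) with hc
  set p : ℝ → ℝ := fun s => ρ + s * (ρ' - ρ) with hp
  set a : ℝ → ℝ := fun s => ∫ u in ball (0 : ℝ²) 1, h (c s + p s • u) with ha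
  set a' : ℝ → ℝ := fun s =>
    ∫ u in ball (0 : ℝ²) 1, h' (c s + p s • u) ((y - z) + (ρ' - ρ) • u) with ha'
  have hd : ∀ u ∈ ball (0 : ℝ²) 1, ‖(y - z) + (ρ' - ρ) • u‖ ≤ dist z y + |ρ - ρ'| := by
    intro u hu
    have hu1 : ‖u‖ ≤ 1 := by simpa using (mem_ball.1 hu).le
    calc _ ≤ ‖y - z‖ + ‖(ρ' - ρ) • u‖ := norm_add_le _ _
      _ ≤ dist z y + |ρ - ρ'| := by
        rw [norm_smul, Real.norm_eq_abs, abs_sub_comm, dist_comm, dist_eq_norm]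
        gcongr
        exact mul_le_of_le_one_right (abs_nonneg _) hu1
  have hd0 : 0 ≤ dist z y + |ρ - ρ'| := by positivity
  have hderiv : ∀ s, HasDerivAt a (a' s) s := by
    intro s
    obtain ⟨M, hM⟩ : ∃ M, ∀ q ∈ (closedBall s 1) ×ˢ (closedBall (0 : ℝ²) 1),
        H (c q.1 + p q.1 • q.2) ≤ M := by
      have hK : IsCompact ((closedBall s 1) ×ˢ (closedBall (0 : ℝ²) 1)) :=
        (isCompact_closedBall _ _).prod (isCompact_closedBall _ _)
      have : ContinuousOn (fun q : ℝ × ℝ² => H (c q.1 + p q.1 • q.2))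
          ((closedBall s 1) ×ˢ (closedBall (0 : ℝ²) 1)) := by
        apply Continuous.continuousOn
        simp only [hc, hp]; fun_prop
      obtain ⟨M, hM⟩ := (hK.image_of_continuousOn this).bddAbove
      exact ⟨M, fun q hq => hM (mem_image_of_mem _ hq)⟩
    refine (hasDerivAt_integral_of_dominated_loc_of_deriv_le
      (F := fun s u => h (c s + p s • u))
      (F' := fun s u => h' (c s + p s • u) ((y - z) + (ρ' - ρ) • u))
      (bound := fun _ => (dist z y + |ρ - ρ'|) * M)
      (ball_mem_nhds s one_pos) ?_ ?_ ?_ ?_ ?_ ?_).2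
    · refine Eventually.of_forall fun s => Continuous.aestronglyMeasurable ?_
      fun_prop
    · refine (Continuous.locallyIntegrable ?_).integrableOn_isCompact
        (isCompact_closedBall (0 : ℝ²) 1) |>.mono_set ball_subset_closedBall
      fun_prop
    · refine Measurable.aestronglyMeasurable (hH'm _ _ ?_ ?_) <;> fun_prop
    · rw [ae_restrict_iff' measurableSet_ball]
      refine Eventually.of_forall fun u hu q hq => ?_
      refine (hbd _ _).trans (mul_le_mul (hd u hu)
        (hM (q, u) ⟨ball_subset_closedBall hq, ball_subset_closedBall hu⟩) (hH0 _) hd0)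
    · exact integrableOn_const (by exact measure_ball_lt_top.ne)
    · refine Eventually.of_forall fun u q _ => ?_
      have : HasDerivAt (fun s => c s + p s • u) ((y - z) + (ρ' - ρ) • u) q := by
        have h1 : HasDerivAt c (y - z) q := by
          have := ((hasDerivAt_id q).smul_const (y - z)).const_add z
          rw [one_smul] at this
          exact this
        have h2 : HasDerivAt p (ρ' - ρ) q := by
          have := ((hasDerivAt_id q).mul_const (ρ' - ρ)).const_add ρ
          rw [one_mul] at this
          exact this
        exact h1.add (h2.smul_const u)
      exact (hh _).comp_hasDerivAt q this
  have hbound : ∀ s ∈ Ico (0 : ℝ) 1, ‖a' s‖ ≤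
      (dist z y + |ρ - ρ'|) * ((m ^ 2)⁻¹ * ∫ x in ball w R, H x) := by
    intro s hs
    have hps : m ≤ p s := by
      simp only [hp]; nlinarith [hs.1, hs.2]
    have hps0 : 0 < p s := hm.trans_le hps
    have hsub : ball (c s) (p s) ⊆ ball w R := by
      refine ball_subset_ball' ?_
      have : dist (c s) w ≤ (1 - s) * dist z w + s * dist y w := by
        have e : c s - w = (1 - s) • (z - w) + s • (y - w) := by
          simp only [hc]; module
        rw [dist_eq_norm, e, dist_eq_norm, dist_eq_norm]
        refine (norm_add_le _ _).trans ?_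
        rw [norm_smul, norm_smul, Real.norm_of_nonneg hs.1,
          Real.norm_of_nonneg (sub_nonneg.2 hs.2.le)]
      simp only [hp]
      nlinarith [hs.1, hs.2]
    have hHint : ∀ A : Set ℝ², A ⊆ closedBall w R → IntegrableOn H A := fun A hA =>
      (hH.locallyIntegrable.integrableOn_isCompact (isCompact_closedBall w R)).mono_set hA
    have hHi : Integrable (fun u => H (c s + p s • u)) (volume.restrict (ball (0 : ℝ²) 1)) := by
      refine (Continuous.locallyIntegrable ?_).integrableOn_isCompact
        (isCompact_closedBall (0 : ℝ²) 1) |>.mono_set ball_subset_closedBall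
      fun_prop
    calc ‖a' s‖ ≤ ∫ u in ball (0 : ℝ²) 1, (dist z y + |ρ - ρ'|) * H (c s + p s • u) := by
          refine norm_integral_le_of_norm_le (hHi.const_mul _) ?_
          rw [ae_restrict_iff' measurableSet_ball]
          exact Eventually.of_forall fun u hu =>
            (hbd _ _).trans (mul_le_mul_of_nonneg_right (hd u hu) (hH0 _))
      _ = (dist z y + |ρ - ρ'|) * ((p s ^ 2)⁻¹ * ∫ x in ball (c s) (p s), H x) := by
          rw [integral_const_mul, setIntegral_ball_rescale H (c s) hps0]
      _ ≤ _ := by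
          gcongr
          · exact integral_nonneg hH0
          · exact Eventually.of_forall hH0
          · exact hHint _ ball_subset_closedBall
  have key := norm_image_sub_le_of_norm_deriv_le_segment_01'
    (fun s _ => (hderiv s).hasDerivWithinAt) hbound
  have e0 : a 0 = (ρ ^ 2)⁻¹ * ∫ x in ball z ρ, h x := by
    rw [← setIntegral_ball_rescale h z (hm.trans_le hmρ)]
    simp [ha, hc, hp]
  have e1 : a 1 = (ρ' ^ 2)⁻¹ * ∫ x in ball y ρ', h x := by
    rw [← setIntegral_ball_rescale h y (hm.trans_le hmρ')]
    simp [ha, hc, hp]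
  rw [setAverage_ball_eq h z (hm.trans_le hmρ), setAverage_ball_eq h y (hm.trans_le hmρ'),
    ← e0, ← e1, ← mul_sub, abs_mul, abs_of_pos (inv_pos.2 Real.pi_pos), abs_sub_comm,
    mul_left_comm]
  exact mul_le_mul_of_nonneg_left key (inv_pos.2 Real.pi_pos).le

/-- Mollification reduces this to the smooth case: the gradient of `η ⋆ f` is bounded by `η ⋆ ‖G‖`,
and only ball integrals have to pass to the limit. -/
theorem abs_setAverage_ball_sub_le {f : ℝ² → ℝ} {G : ℝ² → ℝ²} (hfG : HasWeakGradient f G)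
    {z y w : ℝ²} {ρ ρ' m R : ℝ} (hm : 0 < m)
    (hmρ : m ≤ ρ) (hmρ' : m ≤ ρ') (hz : dist z w + ρ ≤ R) (hy : dist y w + ρ' ≤ R) :
    |(⨍ x in ball z ρ, f x) - ⨍ x in ball y ρ', f x|
      ≤ (dist z y + |ρ - ρ'|) * (Real.pi⁻¹ * ((m ^ 2)⁻¹ * ∫ x in ball w R, ‖G x‖)) := by
  obtain ⟨hf, hG, hw⟩ := hfG
  have hGn : LocallyIntegrable (fun x => ‖G x‖) volume := fun x => (hG x).norm
  let φ : ℕ → ContDiffBump (0 : ℝ²) := fun n =>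
    ⟨1 / (n + 1 : ℝ) / 2, 1 / (n + 1 : ℝ), by positivity, half_lt_self (by positivity)⟩
  have hφ : Tendsto (fun n => (φ n).rOut) atTop (𝓝 0) := tendsto_one_div_add_atTop_nhds_zero_nat
  have hρ := hm.trans_le hmρ
  have hρ' := hm.trans_le hmρ'
  have lim : ∀ (x : ℝ²) {r : ℝ}, 0 < r → Tendsto (fun n => ⨍ t in ball x r,
      ((φ n).normed volume ⋆[lsmul ℝ ℝ, volume] f) t) atTop (𝓝 (⨍ t in ball x r, f t)) := by
    intro x r hr
    simp_rw [setAverage_ball_eq _ x hr]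
    exact ((tendsto_setIntegral_ball_mollify hφ hf r x).const_mul _).const_mul _
  refine le_of_tendsto_of_tendsto ((lim z hρ).sub (lim y hρ')).abs
    ((((tendsto_setIntegral_ball_mollify hφ hGn R w).const_mul _).const_mul _).const_mul _)
    (Eventually.of_forall fun n => ?_)
  set η : ℝ² → ℝ := (φ n).normed volume with hη
  have hηsm : ContDiff ℝ ∞ η := (φ n).contDiff_normed
  have hηs : HasCompactSupport η := (φ n).hasCompactSupport_normed
  have hη0 : ∀ x, 0 ≤ η x := fun x => (φ n).nonneg_normed x
  refine abs_setAverage_ball_sub_le_of_hasFDerivAt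
    (fun x => hηs.hasFDerivAt_convolution_left (lsmul ℝ ℝ) (hηsm.of_le (by simp)) hf x)
    (hηs.continuous_convolution_left _ hηsm.continuous hGn)
    (fun x => integral_nonneg fun t => mul_nonneg (hη0 t) (norm_nonneg _)) ?_ hm hmρ hmρ' hz hy
  intro x v
  have hψ : ContDiff ℝ ∞ fun t => η (x - t) := hηsm.comp (contDiff_const.sub contDiff_id)
  have hψs : HasCompactSupport fun t => η (x - t) :=
    hηs.comp_homeomorph (Homeomorph.subLeft x)
  have hψd : ∀ t u, fderiv ℝ (fun t => η (x - t)) t u = -fderiv ℝ η (x - t) u := by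
    intro t u
    have h1 : HasFDerivAt η (fderiv ℝ η (x - t)) (x - t) :=
      (hηsm.differentiable (by simp) _).hasFDerivAt
    have h2 := h1.comp t ((hasFDerivAt_id t).const_sub x)
    have h3 : HasFDerivAt (fun t => η (x - t)) _ t := h2
    rw [h3.fderiv]
    simp
  have hFi : Integrable fun t => f t • fderiv ℝ (fun t => η (x - t)) t := by
    refine hf.integrable_smul_right_of_hasCompactSupport ?_ (hψs.fderiv ℝ)
    exact hψ.continuous_fderiv (by simp)
  have hGi : Integrable fun t => η (x - t) • G t :=
    hG.integrable_smul_left_of_hasCompactSupport hψ.continuous hψs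
  have e1 : (fderiv ℝ η ⋆[(lsmul ℝ ℝ).precompL ℝ², volume] f) x v
      = -∫ t, f t * fderiv ℝ (fun t => η (x - t)) t v := by
    rw [convolution_eq_swap, ContinuousLinearMap.integral_apply, ← integral_neg]
    · refine integral_congr_ae (Eventually.of_forall fun t => ?_)
      simp [precompL_apply, hψd, mul_comm]
    · refine hFi.neg.congr (Eventually.of_forall fun t => ?_)
      ext u
      simp [precompL_apply, hψd, mul_comm]
  have hv : v = ∑ i, v i • EuclideanSpace.single i (1 : ℝ) := by
    ext j; fin_cases j <;> simp
  -- The weak gradient is tested against `t ↦ η (x - t)`, coordinate by coordinate.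
  have e2 : -∫ t, f t * fderiv ℝ (fun t => η (x - t)) t v
      = ∫ t, η (x - t) * inner ℝ v (G t) := by
    have h1 : ∀ i, Integrable fun t => v i * (f t * fderiv ℝ (fun t => η (x - t)) t
        (EuclideanSpace.single i (1 : ℝ))) := fun i =>
      (hFi.apply_continuousLinearMap _).const_mul _
    have h2 : ∀ i, Integrable fun t => v i * (G t i * η (x - t)) := fun i => by
      have := ((EuclideanSpace.proj (𝕜 := ℝ) i).integrable_comp hGi).const_mul (v i)
      refine this.congr (Eventually.of_forall fun t => ?_)
      simp [mul_comm]
    calc -∫ t, f t * fderiv ℝ (fun t => η (x - t)) t v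
        = -∫ t, ∑ i, v i * (f t * fderiv ℝ (fun t => η (x - t)) t
            (EuclideanSpace.single i (1 : ℝ))) := by
          congr 2; funext t
          conv_lhs => rw [hv]
          simp only [map_sum, map_smul, smul_eq_mul, Finset.mul_sum]
          exact Finset.sum_congr rfl fun i _ => by ring
      _ = ∑ i, v i * ∫ t, G t i * η (x - t) := by
          rw [integral_finsetSum _ fun i _ => h1 i, ← Finset.sum_neg_distrib]
          refine Finset.sum_congr rfl fun i _ => ?_
          rw [integral_const_mul, hw _ hψ hψs i]
          ring
      _ = ∫ t, ∑ i, v i * (G t i * η (x - t)) := by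
          rw [integral_finsetSum _ fun i _ => h2 i]
          exact Finset.sum_congr rfl fun i _ => (integral_const_mul _ _).symm
      _ = _ := by
          congr 1; funext t
          simp only [PiLp.inner_apply, Finset.mul_sum]
          exact Finset.sum_congr rfl fun i _ => by simp; ring
  rw [e1, e2, convolution_eq_swap, ← integral_const_mul, ← Real.norm_eq_abs]
  refine norm_integral_le_of_norm_le ?_ (Eventually.of_forall fun t => ?_)
  · refine (hGi.norm.const_mul ‖v‖).congr (Eventually.of_forall fun t => ?_)
    simp [norm_smul, abs_of_nonneg (hη0 _)]
  · rw [norm_mul, Real.norm_of_nonneg (hη0 _), lsmul_apply, smul_eq_mul, mul_left_comm]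
    exact mul_le_mul_of_nonneg_left (norm_inner_le_norm _ _) (hη0 _)

end Poincare

/-! ### Level values against means over balls. -/

section Oscillation

local notation "ℝ²" => EuclideanSpace ℝ (Fin 2)

/-- Weak-type maximal estimate: if every point were bad, a Vitali subfamily of disjoint bad
intervals would give `μ` too much mass. The factor is `10 = 2 * 5`: an interval of radius `p` has
length `2 p`, and Vitali enlarges it five times. -/
theorem exists_mem_Icc_forall_measure_closedBall_le (μ : Measure ℝ) {a b K R : ℝ} (hK : 0 ≤ K)
    (h : 10 * μ univ < ENNReal.ofReal (K * (b - a))) :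
    ∃ s ∈ Icc a b, ∀ ρ, 0 < ρ → ρ ≤ R → μ (closedBall s ρ) ≤ ENNReal.ofReal (K * ρ) := by
  by_contra! hcon
  choose! p hp0 hpR hp using hcon
  obtain ⟨u, hut, hdisj, hcov⟩ := Vitali.exists_disjoint_subfamily_covering_enlargement_closedBall
    (Icc a b) id p R hpR 5 (by norm_num)
  simp only [id] at hdisj hcov
  have hcount : u.Countable := hdisj.countable_of_nonempty_interior fun s hs =>
    ⟨s, ball_subset_interior_closedBall (mem_ball_self (hp0 s (hut hs)))⟩
  have hsub : Icc a b ⊆ ⋃ s ∈ u, closedBall s (5 * p s) := fun s hs => by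
    obtain ⟨c, hc, hsc⟩ := hcov s hs
    exact mem_biUnion hc (hsc (mem_closedBall_self (hp0 s hs).le))
  have : Countable u := hcount.to_subtype
  refine absurd h (not_lt.2 ?_)
  calc ENNReal.ofReal (K * (b - a)) = ENNReal.ofReal K * volume (Icc a b) := by
        rw [Real.volume_Icc, ENNReal.ofReal_mul hK]
    _ ≤ ENNReal.ofReal K * ∑' s : u, volume (closedBall (s : ℝ) (5 * p s)) := by
        gcongr
        exact (measure_mono hsub).trans (measure_biUnion_le _ hcount _)
    _ = ∑' s : u, 10 * ENNReal.ofReal (K * p s) := by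
        rw [← ENNReal.tsum_mul_left]
        congr 1; funext s
        rw [Real.volume_closedBall, ← ENNReal.ofReal_mul hK,
          show (10 : ENNReal) = ENNReal.ofReal 10 by norm_num, ← ENNReal.ofReal_mul (by norm_num)]
        congr 1; ring
    _ ≤ 10 * ∑' s : u, μ (closedBall (s : ℝ) (p s)) := by
        rw [← ENNReal.tsum_mul_left]
        refine ENNReal.tsum_le_tsum fun s => ?_
        gcongr
        exact (hp s (hut s.2)).le
    _ = 10 * μ (⋃ s ∈ u, closedBall s (p s)) := by
        rw [measure_biUnion hcount hdisj fun _ _ => measurableSet_closedBall]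
    _ ≤ 10 * μ univ := by gcongr; exact subset_univ _

/-- The measure with density `‖G‖²`. -/
noncomputable def energyMeasure (G : ℝ² → ℝ²) : Measure ℝ² :=
  volume.withDensity fun x => ENNReal.ofReal (‖G x‖ ^ 2)

theorem energyMeasure_apply {G : ℝ² → ℝ²} (hG : MemLp G 2 volume) {A : Set ℝ²}
    (hA : MeasurableSet A) : energyMeasure G A = ENNReal.ofReal (∫ x in A, ‖G x‖ ^ 2) := by
  rw [energyMeasure, withDensity_apply _ hA, ofReal_integral_eq_lintegral_ofReal]
  · exact (hG.integrable_norm_pow (by norm_num)).integrableOn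
  · exact Eventually.of_forall fun x => by positivity

theorem isFiniteMeasure_energyMeasure {G : ℝ² → ℝ²} (hG : MemLp G 2 volume) :
    IsFiniteMeasure (energyMeasure G) :=
  ⟨by rw [energyMeasure_apply hG .univ]; exact ENNReal.ofReal_lt_top⟩

theorem setIntegral_norm_ball_le {G : ℝ² → ℝ²} (hG : MemLp G 2 volume)
    (hGl : LocallyIntegrable G volume) {z : ℝ²} {ρ q : ℝ}
    (hρ : 0 < ρ) (hq : 0 < q) (h : energyMeasure G (ball z ρ) ≤ ENNReal.ofReal (q ^ 2)) :
    ∫ x in ball z ρ, ‖G x‖ ≤ 4 * ρ * q := by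
  rw [energyMeasure_apply hG measurableSet_ball, ENNReal.ofReal_le_ofReal_iff (by positivity)] at h
  have h2 : IntegrableOn (fun x => ‖G x‖ ^ 2) (ball z ρ) :=
    (hG.integrable_norm_pow (by norm_num)).integrableOn
  have h1 : IntegrableOn (fun x => ‖G x‖) (ball z ρ) :=
    ((hGl.integrableOn_isCompact (isCompact_closedBall z ρ)).mono_set ball_subset_closedBall).norm
  have h0 : IntegrableOn (fun _ : ℝ² => q / ρ / 2) (ball z ρ) :=
    integrableOn_const (by exact measure_ball_lt_top.ne)
  have hv : volume.real (ball z ρ) = ρ ^ 2 * Real.pi := by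
    rw [measureReal_def, EuclideanSpace.volume_ball_fin_two, ENNReal.toReal_mul,
      ENNReal.toReal_pow, ENNReal.toReal_ofReal hρ.le]
    simp [Real.pi_pos.le]
  -- Weighted AM-GM, applied pointwise, takes the place of Cauchy–Schwarz.
  calc ∫ x in ball z ρ, ‖G x‖ ≤ ∫ x in ball z ρ, (ρ / q / 2 * ‖G x‖ ^ 2 + q / ρ / 2) := by
        refine integral_mono h1 ((h2.const_mul _).add h0) fun x => ?_
        have : ρ / q / 2 * ‖G x‖ ^ 2 + q / ρ / 2 - ‖G x‖
            = ρ / q / 2 * (‖G x‖ - q / ρ) ^ 2 := by field_simp; ring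
        have h3 : 0 ≤ ρ / q / 2 * (‖G x‖ - q / ρ) ^ 2 := by positivity
        simp only
        linarith
    _ = ρ / q / 2 * (∫ x in ball z ρ, ‖G x‖ ^ 2) + ρ ^ 2 * Real.pi * (q / ρ / 2) := by
        rw [integral_add (h2.const_mul _) h0, integral_const_mul, setIntegral_const, hv,
          smul_eq_mul]
    _ ≤ ρ / q / 2 * q ^ 2 + ρ ^ 2 * 4 * (q / ρ / 2) := by
        gcongr
        exact Real.pi_le_four
    _ = 5 / 2 * ρ * q := by field_simp; ring
    _ ≤ _ := by nlinarith [mul_pos hρ hq]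

theorem preciseRep_eq {f : ℝ² → ℝ} {x : ℝ²} {c : ℝ}
    (h : Tendsto (fun r : ℝ => ⨍ y in ball x r, f y) (𝓝[>] 0) (𝓝 c)) : preciseRep f x = c := by
  have hex : ∃ c : ℝ, Tendsto (fun r : ℝ => ⨍ y in ball x r, f y) (𝓝[>] 0) (𝓝 c) := ⟨c, h⟩
  rw [preciseRep, dif_pos hex]
  exact tendsto_nhds_unique hex.choose_spec h

/-- Linear decay of the energy makes the oscillation between radii `r / 4 ^ k` and `r / 4 ^ (k + 1)`
of order `lam / 2 ^ k`, which is summable. Thus the means converge at `z`, and the precise value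
there is a true limit, not the default `0`. -/
theorem abs_preciseRep_sub_setAverage_le {f : ℝ² → ℝ} {G : ℝ² → ℝ²} (hfG : HasWeakGradient f G)
    (hG : MemLp G 2 volume) {z : ℝ²} {r lam : ℝ} (hr : 0 < r) (hlam : 0 < lam)
    (h : ∀ ρ, 0 < ρ → ρ ≤ r →
      energyMeasure G (ball z ρ) ≤ ENNReal.ofReal (lam ^ 2 / r * ρ)) :
    |preciseRep f z - ⨍ x in ball z r, f x| ≤ 64 * lam := by
  set A : ℝ → ℝ := fun ρ => ⨍ x in ball z ρ, f x with hA
  -- All radii between two consecutive scales are covered, so that the limit exists along every `ρ ↘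
  -- 0`. The bound has the form `C / 2 / 2 ^ k` so that it sums to `C = 64 * lam`.
  have hstep : ∀ (k : ℕ) (ρ' : ℝ), r / 4 ^ (k + 1) ≤ ρ' → ρ' ≤ r / 4 ^ k →
      |A (r / 4 ^ k) - A ρ'| ≤ 64 * lam / 2 / 2 ^ k := by
    intro k ρ' h1 h2
    set ρ := r / 4 ^ k with hρdef
    have hρ : 0 < ρ := by positivity
    have hρ4 : r / 4 ^ (k + 1) = ρ / 4 := by rw [hρdef, pow_succ]; field_simp
    rw [hρ4] at h1
    have hI : ∫ x in ball z ρ, ‖G x‖ ≤ 4 * ρ * (lam / 2 ^ k) := by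
      refine setIntegral_norm_ball_le hG hfG.2.1 hρ (by positivity) ?_
      refine (h ρ hρ (div_le_self hr.le (one_le_pow₀ (by norm_num)))).trans_eq ?_
      congr 1
      rw [hρdef, show (4 : ℝ) = 2 ^ 2 by norm_num, ← pow_mul, div_pow, ← pow_mul, mul_comm k 2]
      field_simp
    have hP := abs_setAverage_ball_sub_le hfG (z := z) (y := z) (w := z) (ρ := ρ) (ρ' := ρ')
      (m := ρ / 4) (R := ρ) (by positivity) (by linarith) h1 (by simp) (by simpa using h2)
    refine hP.trans ?_
    rw [dist_self, zero_add, abs_of_nonneg (by linarith)]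
    have hI0 : 0 ≤ ∫ x in ball z ρ, ‖G x‖ := integral_nonneg fun _ => norm_nonneg _
    calc (ρ - ρ') * (Real.pi⁻¹ * (((ρ / 4) ^ 2)⁻¹ * ∫ x in ball z ρ, ‖G x‖))
        ≤ ρ * (2⁻¹ * (((ρ / 4) ^ 2)⁻¹ * (4 * ρ * (lam / 2 ^ k)))) := by
          gcongr
          · linarith
          · exact Real.two_le_pi
      _ = _ := by field_simp; norm_num
  have hdist : ∀ n : ℕ, dist (A (r / 4 ^ n)) (A (r / 4 ^ (n + 1))) ≤ 64 * lam / 2 / 2 ^ n := by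
    intro n
    refine hstep n _ le_rfl ?_
    rw [pow_succ]
    gcongr
    nlinarith [pow_pos (show (0 : ℝ) < 4 by norm_num) n]
  obtain ⟨c, hc⟩ := cauchySeq_tendsto_of_complete (cauchySeq_of_le_geometric_two hdist)
  have hlim : Tendsto A (𝓝[>] 0) (𝓝 c) := by
    rw [Metric.tendsto_nhdsWithin_nhds]
    intro ε hε
    have h2 : Tendsto (fun k : ℕ => 64 * lam / 2 / (2 : ℝ) ^ k) atTop (𝓝 0) :=
      tendsto_const_nhds.div_atTop (tendsto_pow_atTop_atTop_of_one_lt (by norm_num))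
    obtain ⟨N, hN⟩ := eventually_atTop.1 ((h2.eventually (gt_mem_nhds (half_pos hε))).and
      (hc.eventually (ball_mem_nhds c (half_pos hε))))
    refine ⟨r / 4 ^ N, by positivity, fun ρ hρ0 hρ => ?_⟩
    have hρ0 : 0 < ρ := hρ0
    rw [Real.dist_eq, sub_zero, abs_of_pos hρ0] at hρ
    obtain ⟨k, hk1, hk2⟩ := exists_nat_pow_near_of_lt_one (x := ρ / r) (y := 1 / 4)
      (by positivity)
      ((div_le_one hr).2 (hρ.le.trans (div_le_self hr.le (one_le_pow₀ (by norm_num)))))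
      (by norm_num) (by norm_num)
    rw [one_div, inv_pow, lt_div_iff₀ hr, inv_mul_eq_div] at hk1
    rw [one_div, inv_pow, div_le_iff₀ hr, inv_mul_eq_div] at hk2
    have hNk : N ≤ k := by
      by_contra! hlt
      have : r / 4 ^ N ≤ r / 4 ^ (k + 1) := by
        gcongr
        · norm_num
        · omega
      linarith
    have e1 := hstep k ρ hk1.le hk2
    have e2 := hN k hNk
    calc dist (A ρ) c ≤ dist (A ρ) (A (r / 4 ^ k)) + dist (A (r / 4 ^ k)) c := dist_triangle _ _ _
      _ < ε / 2 + ε / 2 := by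
        refine add_lt_add ?_ e2.2
        rw [dist_comm]
        exact lt_of_le_of_lt e1 e2.1
      _ = ε := add_halves ε
  rw [preciseRep_eq hlim, abs_sub_comm]
  have := dist_le_of_le_geometric_two_of_tendsto₀ hdist hc
  simpa [Real.dist_eq] using this

theorem abs_setAverage_ball_sub_le_of_dist_le {f : ℝ² → ℝ} {G : ℝ² → ℝ²}
    (hfG : HasWeakGradient f G) (hG : MemLp G 2 volume) {z y : ℝ²} {r lam : ℝ} (hr : 0 < r)
    (hlam : 0 < lam) (hz : dist z y ≤ r)
    (h : energyMeasure G (ball y (2 * r)) ≤ ENNReal.ofReal (lam ^ 2)) :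
    |(⨍ x in ball z r, f x) - ⨍ x in ball y r, f x| ≤ 4 * lam := by
  have hI : ∫ x in ball y (2 * r), ‖G x‖ ≤ 4 * (2 * r) * lam :=
    setIntegral_norm_ball_le hG hfG.2.1 (by positivity) hlam h
  have hP := abs_setAverage_ball_sub_le hfG (z := z) (y := y) (w := y) (ρ := r) (ρ' := r)
    (m := r) (R := 2 * r) hr le_rfl le_rfl (by linarith) (by rw [dist_self]; linarith)
  refine hP.trans ?_
  rw [sub_self, abs_zero, add_zero]
  have hI0 : 0 ≤ ∫ x in ball y (2 * r), ‖G x‖ := integral_nonneg fun _ => norm_nonneg _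
  calc dist z y * (Real.pi⁻¹ * ((r ^ 2)⁻¹ * ∫ x in ball y (2 * r), ‖G x‖))
      ≤ r * (2⁻¹ * ((r ^ 2)⁻¹ * (4 * (2 * r) * lam))) := by
        gcongr
        exact Real.two_le_pi
    _ = 4 * lam := by field_simp

theorem IsPreconnected.exists_mem_dist_eq {X : Type*} [PseudoMetricSpace X] {C : Set X}
    (hC : IsPreconnected C) {y : X} {p q : X} (hp : p ∈ C) (hq : q ∈ C) {s : ℝ}
    (h1 : dist p y ≤ s) (h2 : s ≤ dist q y) : ∃ z ∈ C, dist z y = s :=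
  hC.intermediate_value hp hq (continuous_id.dist continuous_const).continuousOn ⟨h1, h2⟩

/-- If a preconnected set in a level set of the precise representative crosses the annulus of
radii `r / 2` and `r` about `y`, the level is close to the mean over `B(y, r)`. -/
theorem abs_sub_setAverage_le_of_isPreconnected {f : ℝ² → ℝ} {G : ℝ² → ℝ²}
    (hfG : HasWeakGradient f G) (hG : MemLp G 2 volume) {C : Set ℝ²} (hC : IsPreconnected C)
    {t : ℝ} (ht : ∀ x ∈ C, preciseRep f x = t) {y p q : ℝ²} {r lam : ℝ} (hr : 0 < r)
    (hlam : 0 < lam) (hp : p ∈ C) (hq : q ∈ C) (hpy : dist p y ≤ r / 2) (hqy : r ≤ dist q y)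
    (h : 20 * energyMeasure G (ball y (2 * r)) < ENNReal.ofReal (lam ^ 2)) :
    |t - ⨍ x in ball y r, f x| ≤ 68 * lam := by
  -- Radial projection about `y`: a ball of radius `ρ` centred on the circle of radius `s` projects
  -- into the interval of radius `ρ` about `s`. The interval of radii has length `r / 2`, which
  -- turns the factor 10 into 20.
  set μ : Measure ℝ := ((energyMeasure G).restrict (ball y (2 * r))).map fun x => dist x y with hμ
  have hmeas : Measurable fun x : ℝ² => dist x y := measurable_id.dist measurable_const
  have hμu : 10 * μ univ < ENNReal.ofReal (lam ^ 2 / r * (r - r / 2)) := by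
    rw [hμ, Measure.map_apply hmeas .univ, preimage_univ, Measure.restrict_apply_univ,
      show lam ^ 2 / r * (r - r / 2) = 2⁻¹ * lam ^ 2 by field_simp; ring,
      ENNReal.ofReal_mul (by norm_num)]
    have h2 : (ENNReal.ofReal 2⁻¹) = 2⁻¹ := by
      rw [ENNReal.ofReal_inv_of_pos (by norm_num)]; norm_num
    rw [h2, ← ENNReal.div_eq_inv_mul, ENNReal.lt_div_iff_mul_lt (by simp) (by simp)]
    refine lt_of_eq_of_lt ?_ h
    rw [mul_right_comm]; norm_num
  obtain ⟨s, ⟨hs1, hs2⟩, hs⟩ := exists_mem_Icc_forall_measure_closedBall_le μ (R := r)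
    (by positivity) hμu
  -- Connectedness forces `C` to meet the circle of the good radius.
  obtain ⟨z, hzC, hz⟩ := hC.exists_mem_dist_eq hp hq (hpy.trans hs1) (hs2.trans hqy)
  have h1 : |preciseRep f z - ⨍ x in ball z r, f x| ≤ 64 * lam := by
    refine abs_preciseRep_sub_setAverage_le hfG hG hr hlam fun ρ hρ0 hρr => ?_
    refine le_trans ?_ (hs ρ hρ0 hρr)
    rw [hμ, Measure.map_apply hmeas measurableSet_closedBall,
      Measure.restrict_apply (hmeas measurableSet_closedBall)]
    refine measure_mono fun x hx => ⟨?_, ?_⟩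
    · rw [mem_preimage, mem_closedBall, Real.dist_eq, ← hz]
      exact (abs_dist_sub_le x z y).trans (mem_ball.1 hx).le
    · rw [mem_ball] at hx ⊢
      linarith [dist_triangle x z y]
  have h2 : |(⨍ x in ball z r, f x) - ⨍ x in ball y r, f x| ≤ 4 * lam :=
    abs_setAverage_ball_sub_le_of_dist_le hfG hG hr hlam (hz.trans_le hs2) <|
      le_trans (le_mul_of_one_le_left zero_le (by norm_num)) h.le
  rw [ht z hzC] at h1
  calc _ ≤ |t - ⨍ x in ball z r, f x| + |(⨍ x in ball z r, f x) - ⨍ x in ball y r, f x| :=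
        abs_sub_le _ _ _
    _ ≤ 68 * lam := by linarith

end Oscillation

/-! ### Connected limits of connected sets. -/

section Chains

variable {X : Type*}

/-- One step of length less than `ε` inside `C ∩ B(x, R)`. -/
def ChainStep [PseudoMetricSpace X] (C : Set X) (x : X) (R ε : ℝ) (a b : X) : Prop :=
  b ∈ C ∧ dist b x < R ∧ dist a b < ε

/-- The points reached from `x` by steps of length less than `ε` inside `C ∩ B(x, R)`. -/
def chainSet [PseudoMetricSpace X] (C : Set X) (x : X) (R ε : ℝ) : Set X :=
  {z | Relation.ReflTransGen (ChainStep C x R ε) x z}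

section

variable [PseudoMetricSpace X] {C : Set X} {x : X} {R ε : ℝ}

theorem mem_chainSet_self : x ∈ chainSet C x R ε := Relation.ReflTransGen.refl

theorem mem_and_dist_lt_of_mem_chainSet (hx : x ∈ C) (hR : 0 < R) {z : X}
    (hz : z ∈ chainSet C x R ε) : z ∈ C ∧ dist z x < R := by
  rcases Relation.ReflTransGen.cases_tail hz with h | ⟨w, -, h⟩
  · subst h
    exact ⟨hx, by rwa [dist_self]⟩
  · exact ⟨h.1, h.2.1⟩

/-- If all chain points stayed closer than `R - ε`, every point of `C` within `ε` of one would be a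
chain point too; the chain set would then be relatively clopen in `C`, hence all of `C`. -/
theorem exists_mem_chainSet_le_dist (hC : IsPreconnected C) (hx : x ∈ C) (hε : 0 < ε)
    {y : X} (hy : y ∈ C) (hyR : R ≤ dist y x) :
    ∃ z ∈ chainSet C x R ε, R - ε ≤ dist z x := by
  by_contra! hcon
  have hext : ∀ z ∈ chainSet C x R ε, ∀ w ∈ C, dist w z < ε → w ∈ chainSet C x R ε := by
    intro z hz w hw hwz
    refine Relation.ReflTransGen.tail hz ⟨hw, ?_, by rwa [dist_comm]⟩
    linarith [dist_triangle w z x, hcon z hz]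
  have hsub : C ⊆ ⋃ z ∈ chainSet C x R ε, ball z (ε / 2) := by
    refine hC.subset_of_closure_inter_subset (isOpen_biUnion fun _ _ => isOpen_ball)
      ⟨x, hx, mem_biUnion mem_chainSet_self (mem_ball_self (half_pos hε))⟩ ?_
    rintro w ⟨hw, hwC⟩
    obtain ⟨w', hw', hd⟩ := Metric.mem_closure_iff.1 hw (ε / 2) (half_pos hε)
    obtain ⟨z, hz, hzw⟩ := mem_iUnion₂.1 hw'
    refine mem_biUnion (hext z hz w hwC ?_) (mem_ball_self (half_pos hε))
    rw [mem_ball] at hzw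
    linarith [dist_triangle w w' z]
  obtain ⟨z, hz, hzy⟩ := mem_iUnion₂.1 (hsub hy)
  rw [mem_ball] at hzy
  linarith [dist_triangle y z x, hcon z hz]

theorem exists_chainSet_crossing {A : Set X} (hxA : x ∈ A) {b : X} (hb : b ∈ chainSet C x R ε)
    (hbA : b ∉ A) :
    ∃ c ∈ chainSet C x R ε, ∃ c' ∈ chainSet C x R ε, dist c c' < ε ∧ c ∈ A ∧ c' ∉ A := by
  induction hb with
  | refl => exact absurd hxA hbA
  | @tail p q hp hpq ih =>
    by_cases hpA : p ∈ A
    · exact ⟨p, hp, q, hp.tail hpq, hpq.2.2, hpA, hbA⟩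
    · exact ih hpA

end

/-- Ultralimits of `1 / (k + 1)`-chains in preconnected sets of diameter at least `R` contain a
preconnected set of diameter at least `R`. -/
theorem exists_isPreconnected_ultralimit [MetricSpace X] [ProperSpace X] {C : ℕ → Set X}
    (hC : ∀ k, IsPreconnected (C k)) {x : ℕ → X} {a : X} (hx : Tendsto x atTop (𝓝 a))
    (hxC : ∀ k, x k ∈ C k) {R : ℝ} (hR : 0 < R) (hy : ∀ k, ∃ y ∈ C k, R ≤ dist y (x k))
    (U : Ultrafilter ℕ) (hU : (U : Filter ℕ) ≤ atTop) :
    ∃ K : Set X, IsPreconnected K ∧ a ∈ K ∧ (∃ b ∈ K, R ≤ dist b a) ∧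
      ∀ z ∈ K, ∀ δ > 0, ∀ᶠ k in (U : Filter ℕ), ∃ p ∈ C k, dist p z < δ := by
  set ε : ℕ → ℝ := fun k => 1 / ((k : ℝ) + 1) with hε
  have hε0 : ∀ k, 0 < ε k := fun k => by positivity
  have hεlim : Tendsto ε U (𝓝 0) := tendsto_one_div_add_atTop_nhds_zero_nat.mono_left hU
  have hxU : Tendsto x U (𝓝 a) := hx.mono_left hU
  set P : ℕ → Set X := fun k => chainSet (C k) (x k) R (ε k) with hP
  -- Chains confined to `B(x k, R)` keep `K` compact although the `C k` may be unbounded; the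
  -- ultrafilter gives limits of bounded sequences without choosing subsequences.
  set K : Set X := {z | ∀ δ > 0, ∀ᶠ k in (U : Filter ℕ), ∃ p ∈ P k, dist p z < δ} with hK
  have hPd : ∀ k, ∀ p ∈ P k, p ∈ C k ∧ dist p (x k) < R := fun k p hp =>
    mem_and_dist_lt_of_mem_chainSet (hxC k) hR hp
  have hlim : ∀ ζ : ℕ → X, (∀ᶠ k in (U : Filter ℕ), ζ k ∈ P k) → ∃ z ∈ K, Tendsto ζ U (𝓝 z) := by
    intro ζ hζ
    have hb : ∀ᶠ k in (U : Filter ℕ), ζ k ∈ closedBall a (R + 1) := by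
      filter_upwards [hζ, hxU (ball_mem_nhds a one_pos)] with k h1 h2
      have h2 : dist (x k) a < 1 := h2
      rw [mem_closedBall]
      linarith [dist_triangle (ζ k) (x k) a, (hPd k _ h1).2]
    obtain ⟨z, -, hz⟩ := (isCompact_closedBall a (R + 1)).ultrafilter_le_nhds (U.map ζ)
      (le_principal_iff.2 hb)
    refine ⟨z, fun δ hδ => ?_, hz⟩
    filter_upwards [hζ, hz (ball_mem_nhds z hδ)] with k h1 h2
    exact ⟨ζ k, h1, h2⟩
  have hKclosed : IsClosed K := by
    refine isClosed_of_closure_subset fun z hz δ hδ => ?_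
    obtain ⟨w, hw, hwz⟩ := Metric.mem_closure_iff.1 hz (δ / 2) (half_pos hδ)
    filter_upwards [hw (δ / 2) (half_pos hδ)] with k ⟨p, hp, hpw⟩
    refine ⟨p, hp, ?_⟩
    rw [dist_comm] at hwz
    linarith [dist_triangle p w z]
  have hKcompact : IsCompact K := by
    refine (isCompact_closedBall a (R + 2)).of_isClosed_subset hKclosed fun z hz => ?_
    obtain ⟨k, ⟨p, hp, hpz⟩, h2⟩ := ((hz 1 one_pos).and (hxU (ball_mem_nhds a one_pos))).exists
    have h2 : dist (x k) a < 1 := h2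
    rw [mem_closedBall]
    rw [dist_comm] at hpz
    linarith [dist_triangle4 z p (x k) a, (hPd k _ hp).2]
  have haK : a ∈ K := by
    obtain ⟨z, hz, hz'⟩ := hlim x (Eventually.of_forall fun k => mem_chainSet_self)
    rwa [tendsto_nhds_unique hxU hz']
  have hone : ∀ u v : Set X, IsClosed u → IsClosed v → K ⊆ u ∪ v → Disjoint u v → a ∈ u →
      K ⊆ u := by
    intro u v hu hv hKuv huv hau b hb
    by_contra hbu
    have hbv : b ∈ v := (hKuv hb).resolve_left hbu
    obtain ⟨δ, hδ, hdisj⟩ := (huv.mono inter_subset_right inter_subset_right :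
      Disjoint (K ∩ u) (K ∩ v)).exists_thickenings (hKcompact.inter_right hu)
      (hKclosed.inter hv)
    -- If `K` split into `K ∩ u` and `K ∩ v`, chains would have to leave the neighbourhood of `K ∩
    -- u` in a step shorter than `ε k`. Both ends of that step converge to one point of `K`, which
    -- can lie in neither piece.
    have hcross : ∀ᶠ k in (U : Filter ℕ), ∃ c ∈ P k, ∃ c' ∈ P k, dist c c' < ε k ∧
        c ∈ thickening δ (K ∩ u) ∧ c' ∉ thickening δ (K ∩ u) := by
      filter_upwards [hxU (isOpen_thickening.mem_nhds (self_subset_thickening hδ (K ∩ u)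
        ⟨haK, hau⟩)), hb δ hδ] with k h1 ⟨p, hp, hpb⟩
      refine exists_chainSet_crossing h1 hp fun hp' => ?_
      exact disjoint_left.1 hdisj hp' (mem_thickening_iff.2 ⟨b, ⟨hb, hbv⟩, hpb⟩)
    have hcross' : ∀ k, ∃ q : X × X, (∃ c ∈ P k, ∃ c' ∈ P k, dist c c' < ε k ∧
        c ∈ thickening δ (K ∩ u) ∧ c' ∉ thickening δ (K ∩ u)) → q.1 ∈ P k ∧
        dist q.1 q.2 < ε k ∧ q.1 ∈ thickening δ (K ∩ u) ∧ q.2 ∉ thickening δ (K ∩ u) := by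
      intro k
      by_cases h : ∃ c ∈ P k, ∃ c' ∈ P k, dist c c' < ε k ∧
        c ∈ thickening δ (K ∩ u) ∧ c' ∉ thickening δ (K ∩ u)
      · obtain ⟨c, hc, c', -, h'⟩ := h
        exact ⟨(c, c'), fun _ => ⟨hc, h'⟩⟩
      · exact ⟨(a, a), fun h' => absurd h' h⟩
    choose q hq using hcross'
    obtain ⟨w, hwK, hw⟩ := hlim (fun k => (q k).1) (hcross.mono fun k hk => (hq k hk).1)
    have hw2 : Tendsto (fun k => (q k).2) U (𝓝 w) := by
      refine (tendsto_iff_of_dist ?_).1 hw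
      refine squeeze_zero' (Eventually.of_forall fun _ => dist_nonneg)
        (hcross.mono fun k hk => (hq k hk).2.1.le) hεlim
    rcases hKuv hwK with hwu | hwv
    · obtain ⟨k, hk, hk'⟩ := (hcross.and (hw2 (isOpen_thickening.mem_nhds
        (self_subset_thickening hδ (K ∩ u) ⟨hwK, hwu⟩)))).exists
      exact (hq k hk).2.2.2 hk'
    · obtain ⟨k, hk, hk'⟩ := (hcross.and (hw (isOpen_thickening.mem_nhds
        (self_subset_thickening hδ (K ∩ v) ⟨hwK, hwv⟩)))).exists
      exact disjoint_left.1 hdisj (hq k hk).2.2.1 hk'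
  refine ⟨K, ?_, haK, ?_, fun z hz δ hδ => ?_⟩
  · rw [isPreconnected_iff_subset_of_fully_disjoint_closed hKclosed]
    intro u v hu hv hKuv huv
    rcases hKuv haK with h | h
    · exact Or.inl (hone u v hu hv hKuv huv h)
    · exact Or.inr (hone v u hv hu (union_comm u v ▸ hKuv) huv.symm h)
  · choose y hyC hyR using hy
    choose ζ hζ hζR using fun k =>
      exists_mem_chainSet_le_dist (hC k) (hxC k) (hε0 k) (hyC k) (hyR k)
    obtain ⟨b, hb, hζb⟩ := hlim ζ (Eventually.of_forall hζ)
    refine ⟨b, hb, ?_⟩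
    have h1 : Tendsto (fun k => R - ε k) U (𝓝 (R - 0)) := tendsto_const_nhds.sub hεlim
    rw [sub_zero] at h1
    exact le_of_tendsto_of_tendsto h1 (hζb.dist hxU) (Eventually.of_forall hζR)
  · filter_upwards [hz δ hδ] with k ⟨p, hp, hpz⟩
    exact ⟨p, (hPd k p hp).1, hpz⟩

end Chains

/-! ### Closedness of `levelReach` and the decomposition of `EStar`. -/

section LevelSets

local notation "ℝ²" => EuclideanSpace ℝ (Fin 2)

/-- The points joined inside a level set of `g` by a preconnected set to a point at distance
at least `R`. -/
def levelReach (g : ℝ² → ℝ) (R : ℝ) : Set ℝ² :=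
  {x | ∃ C, IsPreconnected C ∧ x ∈ C ∧ (∃ y ∈ C, R ≤ dist y x) ∧ ∀ z ∈ C, g z = g x}

theorem exists_energyMeasure_ball_lt {G : ℝ² → ℝ²} (hG : MemLp G 2 volume) (y : ℝ²) {c : ENNReal}
    (hc : 0 < c) : ∃ ρ > 0, 20 * energyMeasure G (ball y ρ) < c := by
  have := isFiniteMeasure_energyMeasure hG
  have h0 : energyMeasure G {y} < c / 20 := by
    rw [energyMeasure, withDensity_absolutelyContinuous _ _ (measure_singleton y)]
    exact ENNReal.div_pos hc.ne' (by norm_num)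
  obtain ⟨V, hyV, hV, hVc⟩ := Set.exists_isOpen_lt_of_lt {y} _ h0
  obtain ⟨ρ, hρ, hb⟩ := Metric.isOpen_iff.1 hV y (hyV rfl)
  refine ⟨ρ, hρ, ?_⟩
  have := (measure_mono hb).trans_lt hVc
  rw [ENNReal.lt_div_iff_mul_lt (by norm_num) (by norm_num)] at this
  rwa [mul_comm]

theorem isClosed_levelReach_preciseRep {f : ℝ² → ℝ} (hf : MemW12 f) {R : ℝ} (hR : 0 < R) :
    IsClosed (levelReach (preciseRep f) R) := by
  obtain ⟨-, G, hG, hfG⟩ := hf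
  refine IsSeqClosed.isClosed fun x a hx hxa => ?_
  choose C hC hxC hy hCt using hx
  set U : Ultrafilter ℕ := hyperfilter ℕ
  have hU : (U : Filter ℕ) ≤ atTop := Nat.hyperfilter_le_atTop
  obtain ⟨K, hK, haK, hb, hKC⟩ := exists_isPreconnected_ultralimit hC hxa hxC hR hy U hU
  set t : ℕ → ℝ := fun k => preciseRep f (x k)
  -- The radius `r₀` does not depend on `k`: the energy measure has no atoms, so it is small on
  -- small balls about `z`. The bound `r < R / 2` ensures that `C k`, which has two points at
  -- distance at least `R`, leaves `B(z, r)`.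
  have key : ∀ z ∈ K, ∀ lam > 0, ∃ r₀ > 0, ∀ r, 0 < r → r < r₀ → ∀ᶠ k in (U : Filter ℕ),
      |t k - ⨍ w in ball z r, f w| ≤ 68 * lam := by
    intro z hz lam hlam
    obtain ⟨ρ, hρ, hρc⟩ := exists_energyMeasure_ball_lt hG z
      (ENNReal.ofReal_pos.2 (pow_pos hlam 2))
    refine ⟨min (ρ / 2) (R / 2), by positivity, fun r hr hrr => ?_⟩
    obtain ⟨hr1, hr2⟩ := lt_min_iff.1 hrr
    filter_upwards [hKC z hz (r / 2) (half_pos hr)] with k ⟨p, hp, hpz⟩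
    obtain ⟨y, hyC, hyR⟩ := hy k
    obtain ⟨q, hq, hqz⟩ : ∃ q ∈ C k, r ≤ dist q z := by
      by_contra! hcon
      linarith [dist_triangle_right y (x k) z, hcon y hyC, hcon _ (hxC k)]
    refine abs_sub_setAverage_le_of_isPreconnected hfG hG (hC k) (hCt k) hr hlam hp hq hpz.le hqz
      (lt_of_le_of_lt ?_ hρc)
    gcongr
    linarith
  -- The levels are bounded along the ultrafilter, by comparison with one fixed mean at `a`.
  obtain ⟨T, hT⟩ : ∃ T, Tendsto t U (𝓝 T) := by
    obtain ⟨r₀, hr₀, h⟩ := key a haK 1 one_pos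
    obtain ⟨T, -, hT⟩ := (isCompact_closedBall (⨍ w in ball a (r₀ / 2), f w)
      (68 * 1)).ultrafilter_le_nhds (U.map t)
      (le_principal_iff.2 (h (r₀ / 2) (half_pos hr₀) (half_lt_self hr₀)))
    exact ⟨T, hT⟩
  have hKT : ∀ z ∈ K, preciseRep f z = T := by
    intro z hz
    -- Convergence of the means at `z` is proved here, so `T` is the precise value even if `z` was
    -- not known to be a Lebesgue point.
    refine preciseRep_eq ?_
    rw [Metric.tendsto_nhdsWithin_nhds]
    intro e he
    obtain ⟨r₀, hr₀, h⟩ := key z hz (e / 100) (by positivity)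
    refine ⟨r₀, hr₀, fun r hr hrr => ?_⟩
    have hr : 0 < r := hr
    rw [Real.dist_eq, sub_zero, abs_of_pos hr] at hrr
    have := le_of_tendsto (hT.sub_const _).abs (h r hr hrr)
    rw [dist_comm, Real.dist_eq]
    linarith
  exact ⟨K, hK, haK, hb, fun z hz => (hKT z hz).trans (hKT a haK).symm⟩

theorem IsPreconnected.hausdorffMeasure_one_pos {C : Set ℝ²} (hC : IsPreconnected C) {x y : ℝ²}
    (hx : x ∈ C) (hy : y ∈ C) (hxy : y ≠ x) : 0 < Measure.hausdorffMeasure 1 C := by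
  have hlip : LipschitzWith 1 fun z : ℝ² => dist z x := LipschitzWith.dist_left x
  have h1 := hlip.hausdorffMeasure_image_le (d := 1) zero_le_one C
  rw [hausdorffMeasure_real] at h1
  have hsub : Icc 0 (dist y x) ⊆ (fun z => dist z x) '' C := fun s hs =>
    hC.exists_mem_dist_eq hx hy (by simpa using hs.1) hs.2
  have h2 : 0 < volume (Icc 0 (dist y x)) := by
    rw [Real.volume_Icc, sub_zero, ENNReal.ofReal_pos]
    exact dist_pos.2 hxy
  have h3 := (h2.trans_le (measure_mono hsub)).trans_le h1
  simpa using h3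

theorem EStar_eq_iUnion_levelReach (g : ℝ² → ℝ) :
    EStar g = ⋃ n : ℕ, levelReach g (1 / ((n : ℝ) + 1)) := by
  ext x
  constructor
  · rintro ⟨C, ⟨⟨t, x₀, hx₀, rfl⟩, hpos⟩, hx⟩
    have hlev : ∀ z ∈ connectedComponentIn {z | g z = t} x₀, g z = t := by
      intro z hz
      exact connectedComponentIn_subset {z | g z = t} x₀ hz
    obtain ⟨y, hy, hyx⟩ : ∃ y ∈ connectedComponentIn {z | g z = t} x₀, y ≠ x := by
      by_contra! hcon
      have := Measure.nullSingletonClass_hausdorff ℝ² (d := 1) one_pos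
      refine hpos.ne' (Set.Subsingleton.measure_zero (fun p hp q hq => ?_) _)
      rw [hcon p hp, hcon q hq]
    obtain ⟨n, hn⟩ := exists_nat_one_div_lt (dist_pos.2 hyx)
    exact mem_iUnion.2 ⟨n, _, isPreconnected_connectedComponentIn, hx, ⟨y, hy, hn.le⟩,
      fun z hz => (hlev z hz).trans (hlev x hx).symm⟩
  · intro hx
    obtain ⟨n, C, hC, hxC, ⟨y, hy, hyx⟩, hCg⟩ := mem_iUnion.1 hx
    have hsub : C ⊆ connectedComponentIn {z | g z = g x} x :=
      hC.subset_connectedComponentIn hxC hCg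
    have hne : y ≠ x := dist_pos.1 (lt_of_lt_of_le (by positivity) hyx)
    exact ⟨_, ⟨⟨g x, x, rfl, rfl⟩, isPreconnected_connectedComponentIn.hausdorffMeasure_one_pos
      (hsub hxC) (hsub hy) hne⟩, hsub hxC⟩

end LevelSets

theorem mainTheorem9 (f : EuclideanSpace ℝ (Fin 2) → ℝ) (hf : MemW12 f) :
    MeasurableSet[borel (EuclideanSpace ℝ (Fin 2))] (EStar (preciseRep f)) := by
  rw [EStar_eq_iUnion_levelReach, ← BorelSpace.measurable_eq]
  exact MeasurableSet.iUnion fun n =>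
    (isClosed_levelReach_preciseRep hf (by positivity)).measurableSet
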